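/- All graphs are finite, simple and undirected. Let $G=(V,E)$ be a graph of order $n$, with $V=\{v_1,\dots,v_n\}$, and let $\overline{G}$ be its complement. The Mycielski graph $M(G)$ has vertex set $V\cup V'\cup\{u\}$, where $V'=\{v'_1,\dots,v'_n\}$ consists of $n$ new vertices and $u$ is a further new vertex, and edge set $E\cup\{v_iv'_j : v_iv_j\in E\}\cup\{v'_iu : 1\le i\le n\}$. For a graph $K$, let $\lambda(K)$ be its $L(2,1)$-labeling number: the least integer $k\ge 0$ for which there is a map $f:V(K)\to\{0,1,\dots,k\}$ such that $|f(x)-f(y)|\ge 2$ whenever $d_K(x,y)=1$ and $|f(x)-f(y)|\ge 1$ whenever $d_K(x,y)=2$. A $4$-star matching of a graph $K$ is a (possibly empty) subgraph of $K$ each of whose connected components is isomorphic to a star $K_{1,i}$ with $1\le i\le 4$. Let $s_4(K)$ be the maximum number of vertices of a $4$-star matching of $K$, and let $i_4(K)=|V(K)|-s_4(K)$ be the number of vertices left unmatched by a maximum $4$-star matching. **Theorem.** For every graph $G$ of order $n$: (a) $\lambda(M(G))\le 2n$ if and only if $i_4(\overline{G})\le 4$. (b) For every integer $r\ge 1$,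 $\lambda(M(G))=2n+r$ if and only if $\left\lceil \dfrac{i_4(\overline{G})}{2}\right\rceil=r+2$. -/

import Mathlib

namespace SimpleGraph

/-- The Mycielski graph `M(G)`. A vertex `v` of `G` is `Sum.inl v`, its copy `v'` is
`Sum.inr (Sum.inl v)`, and the root `u` is `Sum.inr (Sum.inr ())`. The edges are those of `G`, the
pairs `v w'` with `v w` an edge of `G`, and all the pairs `v' u`. -/
def mycielski {V : Type*} (G : SimpleGraph V) : SimpleGraph (V ⊕ (V ⊕ Unit)) where
  Adj
    | Sum.inl v, Sum.inl w => G.Adj v w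
    | Sum.inl v, Sum.inr (Sum.inl w) => G.Adj v w
    | Sum.inr (Sum.inl v), Sum.inl w => G.Adj v w
    | Sum.inr (Sum.inl _), Sum.inr (Sum.inr _) => True
    | Sum.inr (Sum.inr _), Sum.inr (Sum.inl _) => True
    | _, _ => False
  symm := ⟨by
    rintro (v | v | v) (w | w | w) h <;> first | exact h | exact G.adj_symm h⟩
  loopless := ⟨by
    rintro (v | v | v) h
    · exact G.loopless.irrefl v h
    · exact h
    · exact h⟩

/-- `f` is an `L(2,1)`-labeling of `G`. The value `0` that `SimpleGraph.dist` takes on vertices in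
different components plays no role, as only the distances `1` and `2` are constrained. -/
def IsL21Labeling {V : Type*} (G : SimpleGraph V) (f : V → ℕ) : Prop :=
  ∀ x y : V, (G.dist x y = 1 → 2 ≤ |(f x : ℤ) - (f y : ℤ)|) ∧
    (G.dist x y = 2 → 1 ≤ |(f x : ℤ) - (f y : ℤ)|)

/-- The `L(2,1)`-labeling number `λ(G)`: the least `k` such that `G` has an `L(2,1)`-labeling with
no label greater than `k`. -/
noncomputable def l21Number {V : Type*} (G : SimpleGraph V) : ℕ :=
  sInf {k : ℕ | ∃ f : V → ℕ, G.IsL21Labeling f ∧ ∀ x, f x ≤ k}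

/-- On a finite graph the set in the definition of `l21Number` is nonempty. -/
theorem exists_isL21Labeling_le {V : Type*} [Finite V] (G : SimpleGraph V) :
    ∃ k : ℕ, ∃ f : V → ℕ, G.IsL21Labeling f ∧ ∀ x, f x ≤ k := by
  obtain ⟨n, ⟨e⟩⟩ := Finite.exists_equiv_fin V
  have key : ∀ x y : V, x ≠ y →
      2 ≤ |((2 * (e x : ℕ) : ℕ) : ℤ) - ((2 * (e y : ℕ) : ℕ) : ℤ)| := by
    intro x y hxy
    have h : (e x : ℕ) ≠ (e y : ℕ) := fun h => hxy (e.injective (Fin.ext h))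
    rw [le_abs]
    omega
  refine ⟨2 * n, fun x => 2 * (e x : ℕ), fun x y => ⟨fun h => ?_, fun h => ?_⟩, fun x => ?_⟩
  · exact key x y (by rintro rfl; simp at h)
  · exact le_trans (by norm_num) (key x y (by rintro rfl; simp at h))
  · have := (e x).isLt
    dsimp only
    omega

/-- A subgraph `H` of `G` is an `m`-star matching if each of its connected components is isomorphic
to a star `K_{1,i}` with `1 ≤ i ≤ m`. (The subgraph without vertices has no components, so it is
one.) -/
def IsStarMatching {V : Type*} {G : SimpleGraph V} (m : ℕ) (H : G.Subgraph) : Prop :=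
  ∀ C : H.coe.ConnectedComponent, ∃ i : ℕ, 1 ≤ i ∧ i ≤ m ∧
    Nonempty (C.toSimpleGraph ≃g completeBipartiteGraph (Fin 1) (Fin i))

/-- The `m`-star matching number `s_m(G)`: the maximum order of an `m`-star matching of `G`. -/
noncomputable def starMatchingNumber {V : Type*} (G : SimpleGraph V) (m : ℕ) : ℕ :=
  sSup {k : ℕ | ∃ H : G.Subgraph, IsStarMatching m H ∧ H.verts.ncard = k}

/-- On a finite graph the supremum in the definition of `starMatchingNumber` is a maximum. -/
theorem isGreatest_starMatchingNumber {V : Type*} [Fintype V] (G : SimpleGraph V) (m : ℕ) :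
    IsGreatest {k : ℕ | ∃ H : G.Subgraph, IsStarMatching m H ∧ H.verts.ncard = k}
      (G.starMatchingNumber m) := by
  have hb : BddAbove {k : ℕ | ∃ H : G.Subgraph, IsStarMatching m H ∧ H.verts.ncard = k} := by
    refine ⟨Nat.card V, ?_⟩
    rintro k ⟨H, -, rfl⟩
    exact Set.ncard_le_card H.verts
  refine ⟨Nat.sSup_mem ⟨0, ⊥, fun C => ?_, by simp⟩ hb, fun k hk => le_csSup hb hk⟩
  obtain ⟨v, -⟩ := C.exists_rep
  exact absurd v.2 (Set.notMem_empty _)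

/-- A star matching of a finite graph has at most as many vertices as the graph, so that the
subtraction in the next definition is not truncated. -/
theorem starMatchingNumber_le_card {V : Type*} [Fintype V] (G : SimpleGraph V) (m : ℕ) :
    G.starMatchingNumber m ≤ Fintype.card V := by
  obtain ⟨H, -, h⟩ := (G.isGreatest_starMatchingNumber m).1
  rw [← h, ← Nat.card_eq_fintype_card]
  exact Set.ncard_le_card H.verts

/-- `i_m(G)`: the number of vertices of `G` left unmatched by a maximum `m`-star matching. -/
noncomputable def starUnmatchedNumber {V : Type*} [Fintype V] (G : SimpleGraph V) (m : ℕ) : ℕ :=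
  Fintype.card V - G.starMatchingNumber m

end SimpleGraph

/-! Write `i` for the number of vertices that a maximum `4`-star matching of the complement misses.
Everything follows from the bound `λ ≤ 2n + ⌈(i - 4)/2⌉`, with the last term read as `0` for `i ≤
4`, and from the reverse inequality for `i ≥ 5`.

Upper bound (`IsStarMap.l21Number_mycielski_le`): list all vertices of the Mycielski graph so that
consecutive ones are nonadjacent, inserting gaps where needed, and label by position. A star of the
complement with at most four leaves gives a gapless block of its vertices and their copies. An
unmatched vertex can be next to its own copy, but its other side must be an end of the list, the
root or a gap. The two ends and the two sides of the root serve four unmatched vertices; each gap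
serves two more.

Lower bound (`IsL21Labeling.card_le_of_mycielski`): by Hall's theorem and an exchange argument,
`exists_isStarMap_barrier` gives a set `I`, independent in the complement and with all its
complement-neighbors in `S`, where `|I| ≥ i + 4|S|`. In `G` each vertex of `I` is adjacent to all
other vertices outside `S`, so the same count of free sides applies. Each vertex of `S` weakens the
bound by at most four sides, since discarding it and its copy exposes two labels with two sides
each. -/

namespace SimpleGraph

/-! ### Star matchings as maps, and a Hall-type min-max theorem for them -/

section StarMap

open scoped Classical

variable {V : Type*} [Fintype V]

/-- The vertices other than `c` that `p` sends to `c`. -/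
noncomputable def starLeaves (p : V → V) (c : V) : Finset V :=
  Finset.univ.filter fun v => v ≠ c ∧ p v = c

/-- The vertices that are related by `p` only to themselves. -/
noncomputable def starUnmatched (p : V → V) : Finset V :=
  Finset.univ.filter fun v => ∀ w, p w = v ∨ p v = w → w = v

/-- A map that encodes an `m`-star matching by sending every vertex to the center of its star, and
every unmatched vertex to itself. -/
structure IsStarMap (K : SimpleGraph V) (m : ℕ) (p : V → V) : Prop where
  idem : ∀ v, p (p v) = p v
  adj : ∀ v, p v ≠ v → K.Adj v (p v)
  card_le : ∀ c, (starLeaves p c).card ≤ m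

theorem mem_starLeaves {p : V → V} {c v : V} : v ∈ starLeaves p c ↔ v ≠ c ∧ p v = c := by
  simp [starLeaves]

theorem mem_starUnmatched {p : V → V} {v : V} :
    v ∈ starUnmatched p ↔ ∀ w, p w = v ∨ p v = w → w = v := by
  simp [starUnmatched]

theorem isStarMap_id (K : SimpleGraph V) (m : ℕ) : IsStarMap K m (id : V → V) where
  idem _ := rfl
  adj v h := absurd rfl h
  card_le c := by
    have : starLeaves (id : V → V) c = ∅ := by
      ext v
      simp [mem_starLeaves]
    simp [this]

/-- An unmatched vertex can join the star of a neighbor that is unmatched or the center of a star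
that is not full. -/
theorem IsStarMap.attach {K : SimpleGraph V} {m : ℕ} {p : V → V} (hp : IsStarMap K m p) {u w : V}
    (hu : u ∈ starUnmatched p) (huw : K.Adj u w) (hw : p w = w)
    (hc : (starLeaves p w).card < m) :
    ∃ q, IsStarMap K m q ∧ (starUnmatched q).card < (starUnmatched p).card := by
  have hne := huw.ne
  rw [mem_starUnmatched] at hu
  have hidem := hp.idem
  refine ⟨fun v => if v = u then w else p v, ⟨fun v => ?_, fun v => ?_, fun c => ?_⟩,
    Finset.card_lt_card ?_⟩
  · grind
  · have := hp.adj v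
    grind
  · by_cases hcw : c = w
    · subst hcw
      refine (Finset.card_le_card (t := insert u (starLeaves p c)) ?_).trans
        ((Finset.card_insert_le _ _).trans hc)
      intro v
      simp only [Finset.mem_insert, mem_starLeaves]
      grind
    · refine (Finset.card_le_card ?_).trans (hp.card_le c)
      intro v
      simp only [mem_starLeaves]
      grind
  · rw [Finset.ssubset_iff_of_subset]
    · refine ⟨u, by rwa [mem_starUnmatched], fun h => ?_⟩
      rw [mem_starUnmatched] at h
      have := h w
      grind
    · intro v
      simp only [mem_starUnmatched]
      intro h x
      have h1 := h x
      have h2 := h w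
      have h3 := h u
      grind

/-- An unmatched vertex can form a new star with a neighbor that is a leaf. -/
theorem IsStarMap.split {K : SimpleGraph V} {m : ℕ} (hm : 2 ≤ m) {p : V → V}
    (hp : IsStarMap K m p) {u w : V}
    (hu : u ∈ starUnmatched p) (huw : K.Adj u w) (hw : p w ≠ w) :
    ∃ q, IsStarMap K m q ∧ (starUnmatched q).card < (starUnmatched p).card := by
  have hne := huw.ne
  have hu' := hu
  rw [mem_starUnmatched] at hu
  have hidem := hp.idem
  obtain ⟨c, hc⟩ : ∃ c, c = p w := ⟨_, rfl⟩
  have hwc := hp.adj w hw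
  rw [← hc] at hwc
  by_cases hl : ∃ x, x ≠ w ∧ x ≠ c ∧ p x = c
  -- The old star keeps the leaf `x`, so `w` can leave it and become the center of a star with leaf
  -- `u`.
  · obtain ⟨x, hxw, hxc, hx⟩ := hl
    refine ⟨fun v => if v = u ∨ v = w then w else p v, ⟨fun v => ?_, fun v => ?_, fun d => ?_⟩,
      Finset.card_lt_card ?_⟩
    · grind
    · have := hp.adj v
      grind
    · by_cases hd : d = w
      · refine (Finset.card_le_card (t := {u}) ?_).trans (by simp; omega)
        intro v
        simp only [Finset.mem_singleton, mem_starLeaves]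
        grind
      · refine (Finset.card_le_card ?_).trans (hp.card_le d)
        intro v
        simp only [mem_starLeaves]
        grind
    · rw [Finset.ssubset_iff_of_subset]
      · refine ⟨u, hu', fun h => ?_⟩
        rw [mem_starUnmatched] at h
        have := h w
        grind
      · intro v
        simp only [mem_starUnmatched]
        intro h y
        have h1 := h y
        have h2 := h w
        have h3 := h u
        have h4 := h x
        have h5 := h c
        grind
  -- The old star is the single edge `wc`: recenter it at `w` with leaves `u` and `c`, which is
  -- where `2 ≤ m` is needed.
  · have hl' : ∀ x, p x = c → x = w ∨ x = c := by grind
    refine ⟨fun v => if v = u ∨ v = w ∨ v = c then w else p v,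
      ⟨fun v => ?_, fun v => ?_, fun d => ?_⟩, Finset.card_lt_card ?_⟩
    · have := hl' v
      have := hl' (p v)
      grind
    · have := hp.adj v
      have := hwc.symm
      grind
    · by_cases hd : d = w
      · refine (Finset.card_le_card (t := {u, c}) ?_).trans (Finset.card_le_two.trans hm)
        intro v
        simp only [Finset.mem_insert, Finset.mem_singleton, mem_starLeaves]
        grind
      · refine (Finset.card_le_card ?_).trans (hp.card_le d)
        intro v
        simp only [mem_starLeaves]
        grind
    · rw [Finset.ssubset_iff_of_subset]
      · refine ⟨u, hu', fun h => ?_⟩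
        rw [mem_starUnmatched] at h
        have := h w
        grind
      · intro v
        simp only [mem_starUnmatched]
        intro h y
        have h1 := h y
        have h2 := h w
        have h3 := h u
        have h5 := h c
        grind

/-- An unmatched vertex can replace a leaf of a star whose center is a neighbor. -/
theorem IsStarMap.swap {K : SimpleGraph V} {m : ℕ} {p : V → V} (hp : IsStarMap K m p) {u w l : V}
    (hu : u ∈ starUnmatched p) (huw : K.Adj u w) (hl : l ∈ starLeaves p w) :
    IsStarMap K m (fun v => if v = u then w else if v = l then l else p v) ∧
      (starUnmatched fun v => if v = u then w else if v = l then l else p v).card ≤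
        (starUnmatched p).card := by
  have hne := huw.ne
  have hu' := hu
  rw [mem_starUnmatched] at hu
  obtain ⟨hlw, hpl⟩ := mem_starLeaves.1 hl
  have hidem := hp.idem
  have hul : u ≠ l := by
    have := hu w
    grind
  refine ⟨⟨fun v => ?_, fun v => ?_, fun d => ?_⟩, ?_⟩
  · have := hu v
    have := hidem v
    have := hidem w
    grind
  · have := hp.adj v
    grind
  · by_cases hd : d = w
    · subst hd
      refine (Finset.card_le_card (t := insert u ((starLeaves p d).erase l)) ?_).trans ?_
      · intro v
        simp only [Finset.mem_insert, Finset.mem_erase, mem_starLeaves]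
        grind
      · refine (Finset.card_insert_le _ _).trans ?_
        rw [Finset.card_erase_add_one hl]
        exact hp.card_le d
    · refine (Finset.card_le_card ?_).trans (hp.card_le d)
      intro v
      simp only [mem_starLeaves]
      grind
  · refine (Finset.card_le_card (t := insert l ((starUnmatched p).erase u)) ?_).trans ?_
    · intro v
      simp only [Finset.mem_insert, Finset.mem_erase, mem_starUnmatched]
      intro h
      by_cases hv : v = l
      · exact Or.inl hv
      refine Or.inr ⟨?_, fun y => ?_⟩
      · have := h w
        grind
      · have h1 := h y
        have h2 := h w
        have h3 := h u
        have h4 := h l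
        grind
    · refine (Finset.card_insert_le _ _).trans ?_
      rw [Finset.card_erase_add_one hu']

/-- If a map sends all but `d` vertices to neighbors, each vertex being used at most `m` times, then
some `m`-star matching leaves at most `d` vertices unmatched. -/
theorem exists_isStarMap_card_starUnmatched_le {K : SimpleGraph V} {m d : ℕ} (hm : 2 ≤ m)
    (g : V → (V × Fin m) ⊕ Fin d) (hg : Function.Injective g)
    (hadj : ∀ v w i, g v = Sum.inl (w, i) → K.Adj v w) :
    ∃ p, IsStarMap K m p ∧ (starUnmatched p).card ≤ d := by
  let agree : (V → V) → Finset V := fun p =>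
    Finset.univ.filter fun v => ∃ i, g v = Sum.inl (p v, i)
  -- Lexicographic order: matched vertices count first, then agreement with `g`. The factor `card V
  -- + 1` exceeds any agreement count.
  let μ : (V → V) → ℕ := fun p =>
    (Fintype.card V - (starUnmatched p).card) * (Fintype.card V + 1) + (agree p).card
  obtain ⟨p, hp, hmax⟩ := Finset.exists_max_image
    (Finset.univ.filter fun p : V → V => IsStarMap K m p) μ
    ⟨id, by simpa using isStarMap_id K m⟩
  simp only [Finset.mem_filter, Finset.mem_univ, true_and] at hp hmax
  have hU : ∀ q : V → V, (starUnmatched q).card ≤ Fintype.card V := fun q => Finset.card_le_univ _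
  have hA : ∀ q, (agree q).card ≤ Fintype.card V := fun q => Finset.card_le_univ _
  have hmin : ¬ ∃ q, IsStarMap K m q ∧ (starUnmatched q).card < (starUnmatched p).card := by
    rintro ⟨q, hq, hlt⟩
    have h1 := hmax q hq
    have h2 : (Fintype.card V - (starUnmatched p).card + 1) * (Fintype.card V + 1) ≤
        (Fintype.card V - (starUnmatched q).card) * (Fintype.card V + 1) :=
      Nat.mul_le_mul_right _ (by have := hU p; omega)
    have h3 := hA p
    simp only [μ] at h1
    rw [Nat.add_mul] at h2
    omega
  -- Suppose `g` sends `u` to a slot of `w`. By maximality of `p`, `w` is the center of a full star.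
  -- As `u` uses one of the `m` slots of `w`, some leaf `l` is not sent there by `g`; trading `l`
  -- for `u` raises the agreement.
  have hdummy : ∀ u ∈ starUnmatched p, ∃ j, g u = Sum.inr j := by
    intro u hu
    rcases hgu : g u with ⟨w, i⟩ | j
    swap
    · exact ⟨j, rfl⟩
    exfalso
    have huw := hadj u w i hgu
    by_cases hw : p w = w
    swap
    · exact hmin (hp.split hm hu huw hw)
    by_cases hc : (starLeaves p w).card < m
    · exact hmin (hp.attach hu huw hw hc)
    have hul : u ∉ starLeaves p w := by
      rw [mem_starLeaves]
      rw [mem_starUnmatched] at hu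
      rintro ⟨h1, h2⟩
      exact huw.ne (hu w (Or.inr h2)).symm
    obtain ⟨l, hl, hgl⟩ : ∃ l ∈ starLeaves p w, ¬ ∃ i, g l = Sum.inl (w, i) := by
      by_contra! hcon
      have h1 : (insert u (starLeaves p w)).card ≤
          (Finset.univ.image fun i : Fin m => (Sum.inl (w, i) : (V × Fin m) ⊕ Fin d)).card := by
        refine Finset.card_le_card_of_injOn g ?_ hg.injOn
        intro v hv
        simp only [Finset.coe_insert, Set.mem_insert_iff, Finset.mem_coe] at hv
        simp only [Finset.coe_image, Set.mem_image]
        rcases hv with rfl | hv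
        · exact ⟨i, by simp, hgu.symm⟩
        · obtain ⟨j, hj⟩ := hcon v hv
          exact ⟨j, by simp, hj.symm⟩
      have h2 := h1.trans Finset.card_image_le
      rw [Finset.card_insert_of_notMem hul] at h2
      simp at h2
      omega
    obtain ⟨hq, hqU⟩ := hp.swap hu huw hl
    have h1 := hmax _ hq
    have hlt : (agree p).card <
        (agree fun v => if v = u then w else if v = l then l else p v).card := by
      apply Finset.card_lt_card
      rw [mem_starLeaves] at hl
      rw [mem_starUnmatched] at hu
      have hpu : p u = u := hu _ (Or.inr rfl)
      have hu_not : ¬ ∃ i, g u = Sum.inl (p u, i) := by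
        rintro ⟨j, hj⟩
        exact (hadj _ _ _ hj).ne hpu.symm
      rw [Finset.ssubset_iff_of_subset]
      · refine ⟨u, ?_, ?_⟩
        · simp only [agree, Finset.mem_filter, Finset.mem_univ, true_and, if_true]
          exact ⟨i, hgu⟩
        · simpa only [agree, Finset.mem_filter, Finset.mem_univ, true_and] using hu_not
      · intro v hv
        simp only [agree, Finset.mem_filter, Finset.mem_univ, true_and] at hv ⊢
        have hvu : v ≠ u := by
          rintro rfl
          exact hu_not hv
        have hvl : v ≠ l := by
          rintro rfl
          rw [hl.2] at hv
          exact hgl hv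
        simpa [hvu, hvl] using hv
    have h2 : (Fintype.card V - (starUnmatched p).card) * (Fintype.card V + 1) ≤
        (Fintype.card V - (starUnmatched fun v => if v = u then w else if v = l then l else
          p v).card) * (Fintype.card V + 1) :=
      Nat.mul_le_mul_right _ (by omega)
    simp only [μ] at h1
    omega
  refine ⟨p, hp, ?_⟩
  have : (starUnmatched p).card ≤
      (Finset.univ.image fun j : Fin d => (Sum.inr j : (V × Fin m) ⊕ Fin d)).card := by
    refine Finset.card_le_card_of_injOn g ?_ hg.injOn
    intro v hv
    obtain ⟨j, hj⟩ := hdummy v hv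
    simp [hj]
  simpa using this.trans Finset.card_image_le

/-- The deficiency version of the star factor theorem of Las Vergnas and of Amahashi and Kano. -/
theorem exists_isStarMap_barrier (K : SimpleGraph V) {m : ℕ} (hm : 2 ≤ m) :
    ∃ p, IsStarMap K m p ∧ ∃ S I : Finset V, Disjoint I S ∧
      (∀ v ∈ I, ∀ w, K.Adj v w → w ∈ S) ∧ (starUnmatched p).card + m * S.card ≤ I.card := by
  let N : Finset V → Finset V := fun X => Finset.univ.filter fun w => ∃ v ∈ X, K.Adj v w
  -- The maximum deficiency `d` is the number of dummy slots that makes Hall's condition hold.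
  obtain ⟨X, -, hX⟩ := Finset.exists_max_image (Finset.univ : Finset (Finset V))
    (fun X => (X.card : ℤ) - m * (N X).card) ⟨∅, by simp⟩
  have hN0 : N ∅ = ∅ := by simp [N]
  obtain ⟨d, hd⟩ : ∃ d : ℕ, (d : ℤ) = X.card - m * (N X).card := by
    refine ⟨_, Int.toNat_of_nonneg ?_⟩
    have := hX ∅ (Finset.mem_univ _)
    simpa [hN0] using this
  let t : V → Finset ((V × Fin m) ⊕ Fin d) := fun v =>
    ((Finset.univ.filter fun w => K.Adj v w) ×ˢ (Finset.univ : Finset (Fin m))).disjSum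
      Finset.univ
  obtain ⟨g, hg, hgt⟩ := (Finset.all_card_le_biUnion_card_iff_exists_injective t).1 (by
    intro Y
    rcases Y.eq_empty_or_nonempty with rfl | ⟨y, hy⟩
    · simp
    have hsub : (N Y ×ˢ (Finset.univ : Finset (Fin m))).disjSum (Finset.univ : Finset (Fin d)) ⊆
        Y.biUnion t := by
      intro z hz
      rw [Finset.mem_biUnion]
      rcases z with ⟨w, i⟩ | j
      · simp only [N, Finset.inl_mem_disjSum, Finset.mem_product, Finset.mem_filter,
          Finset.mem_univ, true_and, and_true] at hz
        obtain ⟨v, hv, hvw⟩ := hz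
        exact ⟨v, hv, by simpa [t] using hvw⟩
      · exact ⟨y, hy, by simp [t]⟩
    refine le_trans ?_ (Finset.card_le_card hsub)
    rw [Finset.card_disjSum, Finset.card_product]
    have := hX Y (Finset.mem_univ _)
    simp only [Finset.card_univ, Fintype.card_fin]
    zify
    linarith)
  obtain ⟨p, hp, hpd⟩ := exists_isStarMap_card_starUnmatched_le hm g hg (K := K) (by
    intro v w i h
    have := hgt v
    rw [h] at this
    simpa [t] using this)
  -- Passing from `X` to `X \ N X` makes the set independent without lowering the deficiency: `X ∩ N
  -- X` and `N (X \ N X)` are disjoint parts of `N X`, so each vertex dropped also removes at least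
  -- one neighbor, worth `m ≥ 1`.
  refine ⟨p, hp, N (X \ N X), X \ N X, ?_, ?_, ?_⟩
  · rw [Finset.disjoint_left]
    intro v hv hv'
    simp only [N, Finset.mem_filter, Finset.mem_univ, true_and, Finset.mem_sdiff] at hv hv'
    obtain ⟨w, hw, hwv⟩ := hv'
    exact hv.2 ⟨w, hw.1, hwv⟩
  · intro v hv w hvw
    simp only [N, Finset.mem_filter, Finset.mem_univ, true_and]
    exact ⟨v, hv, hvw⟩
  · have h1 : (X ∩ N X).card + (N (X \ N X)).card ≤ (N X).card := by
      rw [← Finset.card_union_of_disjoint]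
      · apply Finset.card_le_card
        intro v
        simp only [N, Finset.mem_union, Finset.mem_inter, Finset.mem_filter, Finset.mem_univ,
          true_and, Finset.mem_sdiff]
        rintro (h | ⟨w, hw, hwv⟩)
        · exact h.2
        · exact ⟨w, hw.1, hwv⟩
      · rw [Finset.disjoint_left]
        simp only [N, Finset.mem_inter, Finset.mem_filter, Finset.mem_univ, true_and,
          Finset.mem_sdiff]
        rintro v ⟨hv, -⟩ ⟨w, hw, hwv⟩
        exact hw.2 ⟨v, hv, hwv.symm⟩
    have h2 := Finset.card_inter_add_card_sdiff X (N X)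
    have h3 : (m : ℤ) * ((X ∩ N X).card + (N (X \ N X)).card) ≤ m * (N X).card := by
      exact_mod_cast Nat.mul_le_mul_left m h1
    have h4 : ((X ∩ N X).card : ℤ) ≤ m * (X ∩ N X).card := by
      exact_mod_cast Nat.le_mul_of_pos_left _ (by omega)
    zify at h2 hpd ⊢
    linarith

end StarMap

end SimpleGraph

/-! ### Translation between star maps and star matching subgraphs -/

namespace SimpleGraph

section StarMatching

open scoped Classical

variable {V : Type*} [Fintype V]

/-- A chosen isomorphism to `K_{1,i}` fixes the center of each component, also for a single edge,
where both ends qualify. -/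
theorem exists_isStarMap_of_isStarMatching {K : SimpleGraph V} {m : ℕ} {H : K.Subgraph}
    (hH : IsStarMatching m H) :
    ∃ p, IsStarMap K m p ∧ (starUnmatched p).card + H.verts.ncard ≤ Fintype.card V := by
  choose i hi him φ using hH
  replace φ := fun C => (φ C).some
  let comp : H.verts → H.coe.ConnectedComponent := H.coe.connectedComponentMk
  let cen : H.coe.ConnectedComponent → H.verts := fun C => ((φ C).symm (Sum.inl 0)).1
  have hcen : ∀ C, comp (cen C) = C := fun C => ((φ C).symm (Sum.inl 0)).2
  let p : V → V := fun v => if h : v ∈ H.verts then (cen (comp ⟨v, h⟩) : V) else v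
  have hpH : ∀ v : H.verts, p v = cen (comp v) := fun v => dif_pos v.2
  have hpn : ∀ v, v ∉ H.verts → p v = v := fun v h => dif_neg h
  -- a vertex of a component other than the center corresponds to a leaf
  have hleaf : ∀ (C : H.coe.ConnectedComponent) (v : H.verts) (hv : comp v = C), v ≠ cen C →
      ∃ j, φ C ⟨v, hv⟩ = Sum.inr j := by
    intro C v hv hne
    rcases h : φ C ⟨v, hv⟩ with a | j
    · exfalso
      apply hne
      have h' := (φ C).symm_apply_apply ⟨v, hv⟩
      rw [h, Subsingleton.elim a 0] at h'
      simp only [cen, h']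
    · exact ⟨j, rfl⟩
  refine ⟨p, ⟨fun v => ?_, fun v hv => ?_, fun c => ?_⟩, ?_⟩
  · by_cases h : v ∈ H.verts
    · rw [hpH ⟨v, h⟩, hpH, hcen]
    · rw [hpn v h, hpn v h]
  · by_cases h : v ∈ H.verts
    swap
    · exact absurd (hpn v h) hv
    rw [hpH ⟨v, h⟩] at hv ⊢
    obtain ⟨j, hj⟩ := hleaf _ ⟨v, h⟩ rfl (fun h => hv (congrArg Subtype.val h).symm)
    have h1 : (comp ⟨v, h⟩).toSimpleGraph.Adj ⟨⟨v, h⟩, rfl⟩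
        ((φ (comp ⟨v, h⟩)).symm (Sum.inl 0)) := by
      rw [← (φ (comp ⟨v, h⟩)).map_adj_iff, hj]
      simp
    exact H.adj_sub h1
  · by_cases hc : ∃ v : H.verts, (v : V) ≠ c ∧ p v = c
    · obtain ⟨w, hwc, hw⟩ := hc
      rw [hpH] at hw
      have key : ∀ v ∈ starLeaves p c, ∃ (h : v ∈ H.verts) (h' : comp ⟨v, h⟩ = comp w),
          ∃ j, φ (comp w) ⟨⟨v, h⟩, h'⟩ = Sum.inr j := by
        intro v hv
        rw [mem_starLeaves] at hv
        by_cases h : v ∈ H.verts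
        swap
        · exact absurd ((hpn v h).symm.trans hv.2) hv.1
        have h1 : cen (comp ⟨v, h⟩) = cen (comp w) := by
          apply Subtype.ext
          rw [hw, ← hpH, hv.2]
        have h2 : comp ⟨v, h⟩ = comp w := by rw [← hcen (comp ⟨v, h⟩), h1, hcen]
        refine ⟨h, h2, hleaf _ _ _ ?_⟩
        rintro h3
        apply hv.1
        rw [← hw, ← h3]
      choose h1 h2 j hj using key
      refine le_trans ?_ (him (comp w))
      rw [← Fintype.card_fin (i (comp w)), ← Finset.card_univ, ← Finset.card_attach]
      refine Finset.card_le_card_of_injOn (fun v => j v.1 v.2) (fun _ _ => Finset.mem_univ _) ?_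
      rintro ⟨v, hv⟩ - ⟨x, hx⟩ - hvx
      have h3 := (hj v hv).trans ((congrArg Sum.inr hvx).trans (hj x hx).symm)
      have h4 := (φ (comp w)).injective h3
      exact Subtype.ext (congrArg (fun z => (z.1.1 : V)) h4)
    · have : starLeaves p c = ∅ := by
        rw [Finset.eq_empty_iff_forall_notMem]
        intro v hv
        rw [mem_starLeaves] at hv
        by_cases h : v ∈ H.verts
        · exact hc ⟨⟨v, h⟩, hv⟩
        · exact hv.1 ((hpn v h).symm.trans hv.2)
      simp [this]
  · have h1 : starUnmatched p ⊆ (H.verts.toFinset)ᶜ := by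
      intro v hv
      rw [mem_starUnmatched] at hv
      simp only [Finset.mem_compl, Set.mem_toFinset]
      intro h
      have hpv : p v = v := hv _ (Or.inr rfl)
      have hv' : cen (comp ⟨v, h⟩) = ⟨v, h⟩ := Subtype.ext ((hpH ⟨v, h⟩).symm.trans hpv)
      -- A vertex of `H` fixed by `p` is a center, and as `1 ≤ i` its star has a leaf, which `p`
      -- sends to it.
      let x := (φ (comp ⟨v, h⟩)).symm (Sum.inr ⟨0, hi _⟩)
      have hx : comp x.1 = comp ⟨v, h⟩ := x.2
      have hxv : (x.1 : V) = v := by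
        apply hv
        left
        rw [hpH, hx, hv']
      have hxv' : x = (φ (comp ⟨v, h⟩)).symm (Sum.inl 0) := by
        apply Subtype.ext
        exact (Subtype.ext hxv : x.1 = ⟨v, h⟩).trans hv'.symm
      have := (φ (comp ⟨v, h⟩)).symm.injective hxv'
      simp at this
    have h2 := Finset.card_le_card h1
    rw [Finset.card_compl, ← Set.ncard_eq_toFinset_card'] at h2
    have h3 := Set.ncard_le_card H.verts
    rw [Nat.card_eq_fintype_card] at h3
    omega

/-- The subgraph whose edges join every vertex to its image under `p`. -/
def IsStarMap.subgraph {K : SimpleGraph V} {m : ℕ} {p : V → V} (hp : IsStarMap K m p) :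
    K.Subgraph where
  verts := {v | v ∉ starUnmatched p}
  Adj v w := v ≠ w ∧ (p v = w ∨ p w = v)
  adj_sub := by
    rintro v w ⟨hne, rfl | rfl⟩
    · exact hp.adj v hne.symm
    · exact (hp.adj w hne).symm
  edge_vert := by
    rintro v w ⟨hne, h⟩ hv
    rw [mem_starUnmatched] at hv
    exact hne (hv w h.symm).symm
  symm := ⟨fun v w h => ⟨h.1.symm, h.2.symm⟩⟩

/-- Since `p` is idempotent it is constant along edges, so the components are the fibers of `p` over
the centers. -/
theorem IsStarMap.isStarMatching_subgraph {K : SimpleGraph V} {m : ℕ} {p : V → V}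
    (hp : IsStarMap K m p) : IsStarMatching m hp.subgraph := by
  intro C
  obtain ⟨⟨v, hv⟩, rfl⟩ : ∃ v, hp.subgraph.coe.connectedComponentMk v = C := C.exists_rep
  have hconst : ∀ x y : hp.subgraph.verts, hp.subgraph.coe.Reachable x y → p x = p y := by
    rintro x y ⟨w⟩
    induction w with
    | nil => rfl
    | cons h _ ih =>
      rw [← ih]
      obtain ⟨-, h | h⟩ := h
      · rw [← h, hp.idem]
      · rw [← h, hp.idem]
  have hmem : ∀ x, x ≠ p v → p x = p v → x ∈ hp.subgraph.verts := by
    intro x hx hxv h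
    rw [mem_starUnmatched] at h
    exact hx ((h _ (Or.inr rfl)).symm.trans hxv)
  have hcv : p v ∈ hp.subgraph.verts := by
    intro h
    have hvp := mem_starUnmatched.1 h v (Or.inl rfl)
    exact hv (by rwa [← hvp] at h)
  let c : hp.subgraph.verts := ⟨p v, hcv⟩
  have hreach : ∀ x : hp.subgraph.verts, p x = p v → hp.subgraph.coe.Reachable x c := by
    intro x hx
    by_cases h : (x : V) = p v
    · rw [show x = c from Subtype.ext h]
    · exact Adj.reachable (show hp.subgraph.Adj x c from ⟨h, Or.inl hx⟩)
  have hsupp : ∀ x : hp.subgraph.verts, x ∈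
      (hp.subgraph.coe.connectedComponentMk ⟨v, hv⟩).supp ↔ p x = p v := by
    intro x
    rw [ConnectedComponent.mem_supp_iff, ConnectedComponent.eq]
    exact ⟨hconst _ _, fun h => (hreach x h).trans (hreach ⟨v, hv⟩ rfl).symm⟩
  refine ⟨(starLeaves p (p v)).card, ?_, hp.card_le _, ⟨?_⟩⟩
  · rw [Nat.one_le_iff_ne_zero, Finset.card_ne_zero]
    by_contra hemp
    rw [Finset.not_nonempty_iff_eq_empty] at hemp
    have hl : ∀ x, p x = p v → x = p v := by
      intro x hx
      by_contra hne
      have : x ∈ starLeaves p (p v) := mem_starLeaves.2 ⟨hne, hx⟩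
      simp [hemp] at this
    apply hv
    rw [mem_starUnmatched]
    have hvv := hl v rfl
    rintro w (h | h)
    · rw [hvv]
      apply hl
      rw [h]
      exact hvv
    · rw [← h, ← hvv]
  · let e := (starLeaves p (p v)).equivFin
    refine
      { toFun := fun x => if h : (x.1 : V) = p v then Sum.inl 0 else
          Sum.inr (e ⟨x.1, mem_starLeaves.2 ⟨h, (hsupp x.1).1 x.2⟩⟩)
        invFun := Sum.elim (fun _ => ⟨c, (hsupp c).2 (hp.idem v)⟩) fun j =>
          ⟨⟨(e.symm j).1, hmem _ (mem_starLeaves.1 (e.symm j).2).1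
            (mem_starLeaves.1 (e.symm j).2).2⟩, (hsupp _).2 (mem_starLeaves.1 (e.symm j).2).2⟩
        left_inv := ?_
        right_inv := ?_
        map_rel_iff' := ?_ }
    · rintro x
      apply Subtype.ext
      apply Subtype.ext
      by_cases h : (x.1 : V) = p v
      · simp [h, c]
      · simp [h]
    · rintro (a | j)
      · simp [c, Subsingleton.elim a 0]
      · have := (mem_starLeaves.1 (e.symm j).2).1
        simp [this]
    · rintro ⟨⟨x, hx⟩, hxC⟩ ⟨⟨y, hy⟩, hyC⟩
      have hx' := (hsupp _).1 hxC
      have hy' := (hsupp _).1 hyC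
      have h : ((hp.subgraph.coe.connectedComponentMk ⟨v, hv⟩).toSimpleGraph.Adj
          ⟨⟨x, hx⟩, hxC⟩ ⟨⟨y, hy⟩, hyC⟩) ↔ x ≠ y ∧ (p x = y ∨ p y = x) := Iff.rfl
      refine Iff.trans ?_ h.symm
      simp only at hx' hy'
      by_cases h1 : x = p v <;> by_cases h2 : y = p v <;> simp [h1, h2] <;> grind

theorem IsStarMap.starUnmatchedNumber_le {K : SimpleGraph V} {m : ℕ} {p : V → V}
    (hp : IsStarMap K m p) : K.starUnmatchedNumber m ≤ (starUnmatched p).card := by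
  have h1 := (K.isGreatest_starMatchingNumber m).2
    ⟨hp.subgraph, hp.isStarMatching_subgraph, rfl⟩
  have h2 : hp.subgraph.verts = ((starUnmatched p)ᶜ : Finset V) := by
    ext v
    simp [IsStarMap.subgraph]
  rw [h2, Set.ncard_coe_finset, Finset.card_compl] at h1
  unfold starUnmatchedNumber
  omega

theorem exists_isStarMap_card_starUnmatched_le_starUnmatchedNumber (K : SimpleGraph V) (m : ℕ) :
    ∃ p, IsStarMap K m p ∧ (starUnmatched p).card ≤ K.starUnmatchedNumber m := by
  obtain ⟨H, hH, hcard⟩ := (K.isGreatest_starMatchingNumber m).1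
  obtain ⟨p, hp, h⟩ := exists_isStarMap_of_isStarMatching hH
  refine ⟨p, hp, ?_⟩
  unfold starUnmatchedNumber
  omega

end StarMatching

end SimpleGraph

/-! ### Lower bound: labelings of the Mycielski graph against a barrier -/

namespace SimpleGraph

theorem dist_eq_two_of_common_neighbor {V : Type*} {G : SimpleGraph V} {x y z : V} (hne : x ≠ y)
    (hxy : ¬ G.Adj x y) (hxz : G.Adj x z) (hzy : G.Adj z y) : G.dist x y = 2 := by
  have h1 : G.dist x y ≤ 2 := G.dist_le (Walk.cons hxz (Walk.cons hzy Walk.nil))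
  have h2 : 0 < G.dist x y := Reachable.pos_dist_of_ne ⟨Walk.cons hxz (Walk.cons hzy Walk.nil)⟩ hne
  have h3 : G.dist x y ≠ 1 := fun h => hxy (dist_eq_one_iff_adj.1 h)
  omega

theorem IsL21Labeling.adj {V : Type*} {G : SimpleGraph V} {f : V → ℕ} (hf : G.IsL21Labeling f)
    {x y : V} (hxy : G.Adj x y) : f x + 2 ≤ f y ∨ f y + 2 ≤ f x := by
  have := (hf x y).1 (dist_eq_one_iff_adj.2 hxy)
  rw [le_abs] at this
  omega

theorem IsL21Labeling.ne_of_common_neighbor {V : Type*} {G : SimpleGraph V} {f : V → ℕ}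
    (hf : G.IsL21Labeling f) {x y z : V} (hne : x ≠ y) (hxz : G.Adj x z) (hzy : G.Adj z y) :
    f x ≠ f y := by
  by_cases hxy : G.Adj x y
  · have := hf.adj hxy
    omega
  · have := (hf x y).2 (dist_eq_two_of_common_neighbor hne hxy hxz hzy)
    rw [le_abs] at this
    omega

section Mycielski

variable {V : Type*} {G : SimpleGraph V}

@[simp] theorem mycielski_adj_inl_inl {v w : V} :
    G.mycielski.Adj (Sum.inl v) (Sum.inl w) ↔ G.Adj v w := Iff.rfl

@[simp] theorem mycielski_adj_inl_copy {v w : V} :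
    G.mycielski.Adj (Sum.inl v) (Sum.inr (Sum.inl w)) ↔ G.Adj v w := Iff.rfl

@[simp] theorem mycielski_adj_copy_inl {v w : V} :
    G.mycielski.Adj (Sum.inr (Sum.inl v)) (Sum.inl w) ↔ G.Adj v w := Iff.rfl

@[simp] theorem mycielski_not_adj_inl_root {v : V} {x : Unit} :
    ¬ G.mycielski.Adj (Sum.inl v) (Sum.inr (Sum.inr x)) := fun h => h

@[simp] theorem mycielski_not_adj_root_inl {v : V} {x : Unit} :
    ¬ G.mycielski.Adj (Sum.inr (Sum.inr x)) (Sum.inl v) := fun h => h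

@[simp] theorem mycielski_not_adj_copy_copy {v w : V} :
    ¬ G.mycielski.Adj (Sum.inr (Sum.inl v)) (Sum.inr (Sum.inl w)) := fun h => h

open scoped Classical in
/-- A set `I` of at least three vertices, each adjacent to all other vertices outside `S`, forces
large labels in a labeling of the Mycielski graph. -/
theorem IsL21Labeling.card_le_of_mycielski [Fintype V] {f : V ⊕ (V ⊕ Unit) → ℕ}
    (hf : G.mycielski.IsL21Labeling f) {k : ℕ} (hk : ∀ x, f x ≤ k) {S I : Finset V}
    (hdisj : Disjoint I S) (hI : ∀ v ∈ I, ∀ w, w ≠ v → w ∉ S → G.Adj v w) (hcard : 3 ≤ I.card) :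
    I.card + 4 * Fintype.card V ≤ 2 * k + 4 * S.card + 4 := by
  rw [Finset.disjoint_left] at hdisj
  -- Shifting to labels `1, ..., k + 1` makes room for the slots `0` and `k + 2` just outside the
  -- range.
  let F : V ⊕ (V ⊕ Unit) → ℕ := fun x => f x + 1
  let u : V ⊕ (V ⊕ Unit) := Sum.inr (Sum.inr ())
  have hFpos : ∀ x, 1 ≤ F x := fun x => Nat.le_add_left 1 _
  have hFk : ∀ x, F x ≤ k + 1 := fun x => Nat.succ_le_succ (hk x)
  have hF : ∀ {x y}, G.mycielski.Adj x y → F x + 2 ≤ F y ∨ F y + 2 ≤ F x := by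
    intro x y h
    have := hf.adj h
    simp only [F]
    omega
  have hne : ∀ {x y z}, x ≠ y → G.mycielski.Adj x z → G.mycielski.Adj z y → F x ≠ F y := by
    intro x y z h h1 h2
    have := hf.ne_of_common_neighbor h h1 h2
    simp only [F]
    omega
  -- Such a `z` is a common neighbor of any two vertices outside `S`; this is why `I` needs three
  -- elements.
  have hcommon : ∀ v w, ∃ z ∈ I, z ≠ v ∧ z ≠ w := by
    intro v w
    obtain ⟨z, hz, hz'⟩ := Finset.exists_mem_notMem_of_card_lt_card
      (s := {v, w}) (t := I) (Finset.card_le_two.trans_lt hcard)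
    exact ⟨z, hz, by grind⟩
  let W : Finset (V ⊕ (V ⊕ Unit)) := Sᶜ.disjSum (Sᶜ.disjSum Finset.univ)
  have hWcard : W.card + 2 * S.card = 2 * Fintype.card V + 1 := by
    simp only [W, Finset.card_disjSum, Finset.card_compl, Finset.card_univ, Fintype.card_unit]
    have := Finset.card_le_univ S
    omega
  have hadj : ∀ v ∉ S, ∀ z ∈ I, z ≠ v → G.Adj z v := fun v hv z hz hzv => hI z hz v hzv.symm hv
  have hinj : Set.InjOn F W := by
    intro x hx y hy hxy
    by_contra hxy'
    rcases x with v | v | a <;> rcases y with w | w | b <;>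
      simp only [W, Finset.mem_coe, Finset.inl_mem_disjSum,
        Finset.inr_mem_disjSum, Finset.mem_compl] at hx hy
    · obtain ⟨z, hz, hzv, hzw⟩ := hcommon v w
      exact hne (z := Sum.inl z) hxy' (hadj v hx z hz hzv).symm (hadj w hy z hz hzw) hxy
    · obtain ⟨z, hz, hzv, hzw⟩ := hcommon v w
      exact hne (z := Sum.inl z) hxy' (hadj v hx z hz hzv).symm (hadj w hy z hz hzw) hxy
    · obtain ⟨z, hz, hzv, -⟩ := hcommon v v
      exact hne (z := Sum.inr (Sum.inl z)) hxy' (hadj v hx z hz hzv).symm trivial hxy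
    · obtain ⟨z, hz, hzv, hzw⟩ := hcommon v w
      exact hne (z := Sum.inl z) hxy' (hadj v hx z hz hzv).symm (hadj w hy z hz hzw) hxy
    · exact hne (z := u) hxy' trivial trivial hxy
    · have := hF (x := Sum.inr (Sum.inl v)) (y := Sum.inr (Sum.inr b)) trivial
      omega
    · obtain ⟨z, hz, hzw, -⟩ := hcommon w w
      exact hne (z := Sum.inr (Sum.inl z)) hxy' trivial (hadj w hy z hz hzw) hxy
    · have := hF (x := Sum.inr (Sum.inr a)) (y := Sum.inr (Sum.inl w)) trivial
      omega
    · exact hxy' rfl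
  -- The labels not used on `W`. As `F` is injective on `W`, there are `k - 2n + 2|S|` of them.
  let H : Finset ℕ := Finset.Icc 1 (k + 1) \ W.image F
  have hHcard : W.card + H.card = k + 1 := by
    have h1 : (W.image F).card = W.card := Finset.card_image_of_injOn hinj
    have h2 : W.image F ⊆ Finset.Icc 1 (k + 1) := by
      intro a ha
      obtain ⟨x, -, rfl⟩ := Finset.mem_image.1 ha
      exact Finset.mem_Icc.2 ⟨hFpos x, hFk x⟩
    have h3 := Finset.card_sdiff_add_card_eq_card h2
    simp only [Nat.card_Icc] at h3
    simp only [H]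
    omega
  -- Within `W`, a vertex `v` of `I` is adjacent to everything except itself, its copy and the root.
  have hslot : ∀ v ∈ I, ∀ a : ℕ, (a = F (Sum.inl v) + 1 ∨ a + 1 = F (Sum.inl v)) →
      a = 0 ∨ a = k + 2 ∨ a ∈ insert (F u) H ∨ a = F (Sum.inr (Sum.inl v)) := by
    intro v hv a ha
    have h1 := hFk (Sum.inl v)
    by_cases ha0 : a = 0
    · exact Or.inl ha0
    by_cases hak : a = k + 2
    · exact Or.inr (Or.inl hak)
    by_cases haW : a ∈ W.image F
    swap
    · refine Or.inr (Or.inr (Or.inl (Finset.mem_insert_of_mem ?_)))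
      simp only [H, Finset.mem_sdiff, Finset.mem_Icc]
      exact ⟨by omega, haW⟩
    obtain ⟨x, hx, rfl⟩ := Finset.mem_image.1 haW
    rcases x with w | w | ⟨⟩
    · simp only [W, Finset.inl_mem_disjSum, Finset.mem_compl] at hx
      have hwv : w ≠ v := by
        rintro rfl
        omega
      have := hF (x := Sum.inl v) (y := Sum.inl w) (hI v hv w hwv hx)
      omega
    · simp only [W, Finset.inl_mem_disjSum, Finset.inr_mem_disjSum, Finset.mem_compl] at hx
      by_cases hwv : w = v
      · exact Or.inr (Or.inr (Or.inr (by rw [hwv])))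
      have := hF (x := Sum.inl v) (y := Sum.inr (Sum.inl w)) (hI v hv w hwv hx)
      omega
    · exact Or.inr (Or.inr (Or.inl (Finset.mem_insert_self _ _)))
  -- The free sides: two for each hole and for the root, one for each end of the range. The flag
  -- `true` means that the slot lies above the vertex using it.
  let T : Finset (ℕ × Bool) :=
    (insert (F u) H ×ˢ Finset.univ) ∪ {(0, false), (k + 2, true)}
  have hTcard : T.card ≤ 2 * H.card + 4 := by
    refine (Finset.card_union_le _ _).trans ?_
    have h1 := Finset.card_insert_le (F u) H
    have h2 : ({(0, false), (k + 2, true)} : Finset (ℕ × Bool)).card ≤ 2 := Finset.card_le_two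
    rw [Finset.card_product, Finset.card_univ, Fintype.card_bool]
    omega
  -- The copy of `v` blocks at most one of the two slots beside `v`, so the other is free. Slot and
  -- flag together recover the label of `v`.
  let φ : V → ℕ × Bool := fun v =>
    if (F (Sum.inl v) + 1, true) ∈ T then (F (Sum.inl v) + 1, true)
    else (F (Sum.inl v) - 1, false)
  have hIT : I.card ≤ T.card := by
    refine Finset.card_le_card_of_injOn φ ?_ ?_
    · intro v hv
      simp only [φ]
      split_ifs with h
      · exact h
      have hT : ∀ a b, (a, b) ∈ T ↔ a ∈ insert (F u) H ∨ (a = 0 ∧ b = false) ∨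
          (a = k + 2 ∧ b = true) := by
        intro a b
        simp only [T, Finset.mem_union, Finset.mem_product, Finset.mem_univ, and_true,
          Finset.mem_insert, Finset.mem_singleton, Prod.mk.injEq]
      have h1 := hslot v hv _ (Or.inl rfl)
      have h2 := hslot v hv (F (Sum.inl v) - 1) (Or.inr (by have := hFpos (Sum.inl v); omega))
      have h3 := hFk (Sum.inl v)
      rw [Finset.mem_coe, hT]
      rw [hT] at h
      by_cases h5 : F (Sum.inl v) - 1 ∈ insert (F u) H
      · exact Or.inl h5
      by_cases h6 : F (Sum.inl v) + 1 ∈ insert (F u) H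
      · exact absurd (Or.inl h6) h
      have h7 : F (Sum.inl v) + 1 ≠ k + 2 := fun h7 => h (Or.inr (Or.inr ⟨h7, rfl⟩))
      simp only [h5, h6, false_or] at h1 h2
      refine Or.inr (Or.inl ⟨?_, rfl⟩)
      omega
    · intro v hv w hw hvw
      have hFvw : F (Sum.inl v) = F (Sum.inl w) := by
        have h1 := hFpos (Sum.inl v)
        have h2 := hFpos (Sum.inl w)
        simp only [φ] at hvw
        split_ifs at hvw <;> simp only [Prod.mk.injEq, reduceCtorEq, and_false, and_true] at hvw <;>
          omega
      have := hinj (x₁ := Sum.inl v) (x₂ := Sum.inl w)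
        (by simpa [W] using hdisj hv) (by simpa [W] using hdisj hw) hFvw
      exact Sum.inl_injective this
  omega

end Mycielski

end SimpleGraph

/-! ### Upper bound: labelings read off from lists with gaps -/

namespace SimpleGraph

/-- Two entries of a list of vertices and gaps may be consecutive if they are not adjacent vertices. -/
def GapCompatible {W : Type*} (G : SimpleGraph W) : Option W → Option W → Prop
  | some x, some y => ¬ G.Adj x y
  | _, _ => True

/-- Labeling the vertices by their positions in a list in which consecutive vertices are not adjacent
gives an `L(2,1)`-labeling. -/
theorem l21Number_le_of_isChain {W : Type*} {G : SimpleGraph W} {l : List (Option W)} {k : ℕ}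
    (hl : l.IsChain G.GapCompatible) (hmem : ∀ x, some x ∈ l) (hk : l.length ≤ k + 1) :
    G.l21Number ≤ k := by
  have hpos : ∀ x, ∃ i, ∃ h : i < l.length, l[i] = some x := fun x =>
    List.mem_iff_getElem.1 (hmem x)
  choose f hf hfl using hpos
  -- Distinct positions already settle distance two.
  have hne : ∀ x y, x ≠ y → f x ≠ f y := by
    intro x y hxy h
    have h1 := hfl x
    simp only [h, hfl y, Option.some.injEq] at h1
    exact hxy h1.symm
  have hsucc : ∀ x y, f y = f x + 1 → ¬ G.Adj x y := by
    intro x y h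
    have h1 := List.isChain_iff_getElem.1 hl (f x) (by have := hf y; omega)
    have h2 := hfl y
    simp only [h] at h2
    rwa [hfl, h2] at h1
  refine Nat.sInf_le ⟨f, fun x y => ⟨fun h => ?_, fun h => ?_⟩, fun x => by have := hf x; omega⟩
  · rw [dist_eq_one_iff_adj] at h
    have h1 := hne x y h.ne
    have h2 : f y ≠ f x + 1 := fun h' => hsucc x y h' h
    have h3 : f x ≠ f y + 1 := fun h' => hsucc y x h' h.symm
    rw [le_abs]
    omega
  · have h1 := hne x y (by rintro rfl; simp at h)
    rw [le_abs]
    omega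

section MycielskiUpper

variable {V : Type*} {G : SimpleGraph V}

/-- The entry of a list for a vertex of `G`. -/
abbrev origEntry (v : V) : Option (V ⊕ (V ⊕ Unit)) := some (Sum.inl v)

/-- The entry of a list for the copy of a vertex of `G`. -/
abbrev copyEntry (v : V) : Option (V ⊕ (V ⊕ Unit)) := some (Sum.inr (Sum.inl v))

/-- The entry of a list for the root. -/
abbrev rootEntry : Option (V ⊕ (V ⊕ Unit)) := some (Sum.inr (Sum.inr ()))

/-- A chain of pairwise compatible entries that starts and ends with a copied vertex, if it is
nonempty. -/
structure IsCopyBlock (G : SimpleGraph V) (l : List (Option (V ⊕ (V ⊕ Unit)))) : Prop where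
  chain : l.IsChain G.mycielski.GapCompatible
  head : ∀ x ∈ l.head?, ∃ v, x = copyEntry v
  last : ∀ x ∈ l.getLast?, ∃ v, x = copyEntry v

theorem gapCompatible_copy_copy (v w : V) :
    G.mycielski.GapCompatible (copyEntry v) (copyEntry w) := fun h => h

theorem IsCopyBlock.nil : IsCopyBlock G [] := ⟨by simp, by simp, by simp⟩

theorem IsCopyBlock.append {l₁ l₂ : List (Option (V ⊕ (V ⊕ Unit)))} (h₁ : IsCopyBlock G l₁)
    (h₂ : IsCopyBlock G l₂) : IsCopyBlock G (l₁ ++ l₂) := by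
  refine ⟨List.isChain_append.2 ⟨h₁.chain, h₂.chain, ?_⟩, ?_, ?_⟩
  · intro x hx y hy
    obtain ⟨v, rfl⟩ := h₁.last x hx
    obtain ⟨w, rfl⟩ := h₂.head y hy
    exact gapCompatible_copy_copy v w
  · rw [List.head?_append]
    simp only [Option.mem_def, Option.or_eq_some_iff]
    rintro x (h | ⟨-, h⟩)
    · exact h₁.head x h
    · exact h₂.head x h
  · rw [List.getLast?_append]
    simp only [Option.mem_def, Option.or_eq_some_iff]
    rintro x (h | ⟨-, h⟩)
    · exact h₂.last x h
    · exact h₁.last x h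

/-- The chain `l₁, block, l₂` is compatible if the ends at the block are copied vertices. -/
theorem IsCopyBlock.isChain_between {b l₁ l₂ : List (Option (V ⊕ (V ⊕ Unit)))}
    (hb : IsCopyBlock G b) {v w : V}
    (h₁ : (l₁ ++ [copyEntry v]).IsChain G.mycielski.GapCompatible)
    (h₂ : (copyEntry w :: l₂).IsChain G.mycielski.GapCompatible) :
    (l₁ ++ [copyEntry v] ++ b ++ copyEntry w :: l₂).IsChain G.mycielski.GapCompatible := by
  refine List.isChain_append.2 ⟨List.isChain_append.2 ⟨h₁, hb.chain, ?_⟩, h₂, ?_⟩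
  · intro x hx y hy
    obtain ⟨z, rfl⟩ := hb.head y hy
    simp only [List.getLast?_append, List.getLast?_singleton, Option.some_or, Option.mem_def,
      Option.some.injEq] at hx
    subst hx
    exact gapCompatible_copy_copy _ _
  · intro x hx y hy
    simp only [List.head?_cons, Option.mem_def, Option.some.injEq] at hy
    subst hy
    rw [List.getLast?_append] at hx
    have hx' : ∃ z, x = copyEntry z := by
      have := hb.last
      grind
    obtain ⟨z, rfl⟩ := hx'
    exact gapCompatible_copy_copy _ _

/-- A star with at most four leaves in the complement gives a block of its vertices and their
copies. -/
theorem exists_isCopyBlock_star (c : V) (ls : List V) (h1 : 1 ≤ ls.length) (h4 : ls.length ≤ 4)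
    (hadj : ∀ v ∈ ls, ¬ G.Adj v c) :
    ∃ l, IsCopyBlock G l ∧ (∀ v ∈ c :: ls, origEntry v ∈ l ∧ copyEntry v ∈ l) ∧
      l.length = 2 * (ls.length + 1) := by
  have hadj' : ∀ v ∈ ls, ¬ G.Adj c v := fun v hv h => hadj v hv h.symm
  -- Each leaf stands between its own copy and either the center or the center's copy (or ends up
  -- beside other copies through its own). Center and copy have two sides each, which accommodates
  -- four leaves.
  match ls, h1, h4 with
  | [a], _, _ =>
    refine ⟨[copyEntry a, origEntry a, origEntry c, copyEntry c], ⟨?_, by simp, by simp⟩, ?_, rfl⟩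
    · simpa [GapCompatible] using hadj
    · simp
  | [a, b], _, _ =>
    refine ⟨[copyEntry c, copyEntry a, origEntry a, origEntry c, origEntry b, copyEntry b],
      ⟨?_, by simp, by simp⟩, ?_, rfl⟩
    · simp at hadj hadj'
      simp [GapCompatible, hadj, hadj']
    · simp
  | [a, b, d], _, _ =>
    refine ⟨[copyEntry c, origEntry d, copyEntry d, copyEntry a, origEntry a, origEntry c,
      origEntry b, copyEntry b], ⟨?_, by simp, by simp⟩, ?_, rfl⟩
    · simp at hadj hadj'
      simp [GapCompatible, hadj, hadj']
    · simp
  | [a, b, d, e], _, _ =>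
    refine ⟨[copyEntry e, origEntry e, copyEntry c, origEntry d, copyEntry d, copyEntry a,
      origEntry a, origEntry c, origEntry b, copyEntry b], ⟨?_, by simp, by simp⟩, ?_, rfl⟩
    · simp at hadj hadj'
      simp [GapCompatible, hadj, hadj']
    · simp

/-- A list of vertices and their copies with a gap before every second vertex. -/
def gapList : List V → List (Option (V ⊕ (V ⊕ Unit)))
  | [] => []
  | [x] => [none, origEntry x, copyEntry x]
  | x :: y :: t => none :: origEntry x :: copyEntry x :: copyEntry y :: origEntry y :: gapList t

theorem isChain_gapList : ∀ l : List V, (gapList l).IsChain G.mycielski.GapCompatible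
  | [] => by simp [gapList]
  | [x] => by simp [gapList, GapCompatible]
  | [x, y] => by simp [gapList, GapCompatible]
  | [x, y, z] => by simp [gapList, GapCompatible]
  | x :: y :: z :: w :: t => by
    have := isChain_gapList (z :: w :: t)
    simp only [gapList] at this ⊢
    simp [GapCompatible] at this ⊢
    exact this

/-- A nonempty `gapList` opens with a gap, so any entry may precede it. -/
theorem isChain_cons_gapList (x : Option (V ⊕ (V ⊕ Unit))) (l : List V) :
    (x :: gapList l).IsChain G.mycielski.GapCompatible := by
  have h := isChain_gapList (G := G) l
  match l with
  | [] => simp [gapList]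
  | [y] => exact List.isChain_cons_cons.2 ⟨by cases x <;> trivial, h⟩
  | y :: z :: t => exact List.isChain_cons_cons.2 ⟨by cases x <;> trivial, h⟩

theorem mem_gapList : ∀ (l : List V), ∀ v ∈ l, origEntry v ∈ gapList l ∧ copyEntry v ∈ gapList l
  | [] => by simp
  | [x] => by simp [gapList]
  | x :: y :: t => by
    intro v hv
    have := mem_gapList t v
    simp only [List.mem_cons] at hv
    rcases hv with rfl | rfl | hv
    · simp [gapList]
    · simp [gapList]
    · simp [gapList, this hv]

theorem length_gapList : ∀ l : List V, (gapList l).length = 2 * l.length + (l.length + 1) / 2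
  | [] => by simp [gapList]
  | [x] => by simp [gapList]
  | x :: y :: t => by
    simp only [gapList, List.length_cons, length_gapList t]
    omega

/-- A block and a nonempty list of further vertices can be completed to a chain with the root. -/
theorem IsCopyBlock.exists_isChain {b : List (Option (V ⊕ (V ⊕ Unit)))} (hb : IsCopyBlock G b)
    (us : List V) (hus : us ≠ []) :
    ∃ l : List (Option (V ⊕ (V ⊕ Unit))), l.IsChain G.mycielski.GapCompatible ∧
      (∀ x ∈ b, x ∈ l) ∧ rootEntry ∈ l ∧ (∀ v ∈ us, origEntry v ∈ l ∧ copyEntry v ∈ l) ∧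
      l.length = b.length + 2 * us.length + 1 + (us.length - 4 + 1) / 2 := by
  -- The root is adjacent to every copy but to no original, so at least one original from `us` is
  -- needed to stand beside it.
  match us, hus with
  | [x], _ =>
    refine ⟨[rootEntry, origEntry x] ++ [copyEntry x] ++ b, ?_, ?_, by simp, by simp, by simp⟩
    · refine List.isChain_append.2 ⟨by simp [GapCompatible], hb.chain, ?_⟩
      intro y hy z hz
      obtain ⟨w, rfl⟩ := hb.head z hz
      simp at hy
      subst hy
      exact gapCompatible_copy_copy _ _
    · intro y hy
      simp [hy]
  | [x, y], _ =>
    refine ⟨[rootEntry, origEntry x] ++ [copyEntry x] ++ b ++ copyEntry y :: [origEntry y],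
      hb.isChain_between ?_ ?_, ?_, by simp, by simp, by simp⟩
    · simp [GapCompatible]
    · simp [GapCompatible]
    · intro y hy
      simp [hy]
  | [x, y, z], _ =>
    refine ⟨[origEntry x] ++ [copyEntry x] ++ b ++ copyEntry y ::
      [origEntry y, rootEntry, origEntry z, copyEntry z],
      hb.isChain_between ?_ ?_, ?_, by simp, by simp, by simp⟩
    · simp [GapCompatible]
    · simp [GapCompatible]
    · intro y hy
      simp [hy]
  -- Here `x` takes the front end, `y` and `z` the sides of the root, and `w` the back end or the
  -- side of the first gap.
  | x :: y :: z :: w :: t, _ =>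
    refine ⟨[origEntry x] ++ [copyEntry x] ++ b ++ copyEntry y ::
      [origEntry y, rootEntry, origEntry z, copyEntry z, copyEntry w] ++ origEntry w :: gapList t,
      ?_, ?_, by simp, ?_, ?_⟩
    · rw [List.append_assoc]
      refine hb.isChain_between ?_ ?_
      · simp [GapCompatible]
      · have := isChain_cons_gapList (G := G) (origEntry w) t
        simp [GapCompatible, this]
    · intro y hy
      simp [hy]
    · intro v hv
      have := mem_gapList t v
      simp only [List.mem_cons] at hv
      rcases hv with rfl | rfl | rfl | rfl | hv
      · simp
      · simp
      · simp
      · simp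
      · simp [this hv]
    · simp [length_gapList]
      omega

section

open scoped Classical

variable [Fintype V]

/-- The blocks of the stars whose centers lie in a list. -/
theorem IsStarMap.exists_isCopyBlock {p : V → V} (hp : IsStarMap Gᶜ 4 p) (cs : List V)
    (hcs : ∀ c ∈ cs, p c = c ∧ (starLeaves p c).Nonempty) :
    ∃ b, IsCopyBlock G b ∧ (∀ v, p v ∈ cs → origEntry v ∈ b ∧ copyEntry v ∈ b) ∧
      b.length = 2 * (cs.map fun c => (starLeaves p c).card + 1).sum := by
  induction cs with
  | nil => exact ⟨[], IsCopyBlock.nil, by simp, by simp⟩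
  | cons c t ih =>
    obtain ⟨b, hb, hmem, hlen⟩ := ih fun d hd => hcs d (List.mem_cons_of_mem _ hd)
    obtain ⟨hc, hne⟩ := hcs c List.mem_cons_self
    obtain ⟨l, hl, hlmem, hllen⟩ := exists_isCopyBlock_star (G := G) c (starLeaves p c).toList
      (by simpa [Nat.one_le_iff_ne_zero] using hne.ne_empty) (by simpa using hp.card_le c) (by
        intro v hv
        rw [Finset.mem_toList, mem_starLeaves] at hv
        obtain ⟨h1, rfl⟩ := hv
        exact (compl_adj G _ _).1 (hp.adj v h1.symm) |>.2)
    refine ⟨l ++ b, hl.append hb, fun v hv => ?_, ?_⟩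
    · simp only [List.mem_append]
      rw [List.mem_cons] at hv
      rcases hv with hv | hv
      · have := hlmem v (by
          by_cases h : v = c
          · simp [h]
          · simp [mem_starLeaves, h, hv])
        exact ⟨Or.inl this.1, Or.inl this.2⟩
      · exact ⟨Or.inr (hmem v hv).1, Or.inr (hmem v hv).2⟩
    · simp only [List.length_append, hllen, hlen, Finset.length_toList, List.map_cons,
        List.sum_cons]
      omega

/-- A leaf of a star can be removed from it. -/
theorem IsStarMap.exists_starUnmatched_nonempty [Nonempty V] {K : SimpleGraph V} {m : ℕ}
    {p : V → V} (hp : IsStarMap K m p) :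
    ∃ q, IsStarMap K m q ∧ (starUnmatched q).Nonempty ∧
      (starUnmatched q).card ≤ max 2 (starUnmatched p).card := by
  by_cases hemp : (starUnmatched p).Nonempty
  · exact ⟨p, hp, hemp, le_max_right _ _⟩
  rw [Finset.not_nonempty_iff_eq_empty] at hemp
  obtain ⟨l, hl⟩ : ∃ l, p l ≠ l := by
    by_contra! h
    obtain ⟨v⟩ := ‹Nonempty V›
    have : v ∈ starUnmatched p := by
      rw [mem_starUnmatched]
      intro w
      rw [h, h]
      grind
    simp [hemp] at this
  have hidem := hp.idem
  refine ⟨fun v => if v = l then l else p v, ⟨fun v => ?_, fun v => ?_, fun c => ?_⟩, ⟨l, ?_⟩, ?_⟩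
  · grind
  · have := hp.adj v
    grind
  · refine (Finset.card_le_card ?_).trans (hp.card_le c)
    intro v
    simp only [mem_starLeaves]
    grind
  · rw [mem_starUnmatched]
    grind
  · refine le_max_of_le_left ((Finset.card_le_card (t := {l, p l}) ?_).trans Finset.card_le_two)
    intro v hv
    by_contra hv'
    have : v ∈ starUnmatched p := by
      rw [mem_starUnmatched] at hv ⊢
      intro w
      have h1 := hv w
      have h2 := hv l
      grind
    simp [hemp] at this

/-- A `4`-star matching of the complement bounds the labeling number of the Mycielski graph. -/
theorem IsStarMap.l21Number_mycielski_le {p : V → V} (hp : IsStarMap Gᶜ 4 p) :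
    G.mycielski.l21Number ≤ 2 * Fintype.card V + ((starUnmatched p).card - 4 + 1) / 2 := by
  rcases isEmpty_or_nonempty V with hV | hV
  · refine l21Number_le_of_isChain (l := [rootEntry]) (by simp) ?_ (by simp)
    rintro (v | v | v)
    · exact hV.elim v
    · exact hV.elim v
    · simp
  -- Making room for the root costs nothing: it leaves at most two vertices unmatched if there were
  -- none, and four need no gap.
  obtain ⟨q, hq, hne, hcard⟩ := hp.exists_starUnmatched_nonempty
  let C : Finset V := Finset.univ.filter fun c => q c = c ∧ (starLeaves q c).Nonempty
  obtain ⟨b, hb, hbmem, hblen⟩ := hq.exists_isCopyBlock C.toList (by simp [C])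
  obtain ⟨l, hl, hbl, hroot, humem, hlen⟩ := hb.exists_isChain (starUnmatched q).toList
    (by simpa using hne.ne_empty)
  have hcase : ∀ v, v ∉ starUnmatched q → q v ∈ C := by
    intro v hv
    simp only [C, Finset.mem_filter, Finset.mem_univ, true_and]
    refine ⟨hq.idem v, ?_⟩
    rw [mem_starUnmatched] at hv
    push Not at hv
    obtain ⟨w, hw, hwv⟩ := hv
    have hidem := hq.idem
    by_cases hvv : q v = v
    · exact ⟨w, by rw [mem_starLeaves]; grind⟩
    · exact ⟨v, by rw [mem_starLeaves]; grind⟩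
  have hmem : ∀ v, origEntry v ∈ l ∧ copyEntry v ∈ l := by
    intro v
    by_cases hv : v ∈ starUnmatched q
    · exact humem v (by simpa using hv)
    · have := hbmem v (by simpa using hcase v hv)
      exact ⟨hbl _ this.1, hbl _ this.2⟩
  -- The stars, as fibers of `q` over `C`, partition the matched vertices.
  have hsum : (C.toList.map fun c => (starLeaves q c).card + 1).sum =
      ((starUnmatched q)ᶜ).card := by
    rw [Finset.sum_map_toList]
    rw [Finset.card_eq_sum_card_fiberwise (f := q) (t := C)
      (fun v hv => hcase v (by simpa using hv))]
    refine Finset.sum_congr rfl fun c hc => ?_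
    simp only [C, Finset.mem_filter, Finset.mem_univ, true_and] at hc
    have hnot : c ∉ starLeaves q c := by simp [mem_starLeaves]
    rw [← Finset.card_insert_of_notMem hnot]
    congr 1
    ext v
    simp only [Finset.mem_insert, mem_starLeaves, Finset.mem_filter, Finset.mem_compl,
      mem_starUnmatched]
    obtain ⟨hcc, x, hx⟩ := hc
    rw [mem_starLeaves] at hx
    constructor
    · intro h
      by_cases hvc : v = c
      · subst hvc
        refine ⟨fun h' => hx.1 (h' x (Or.inl hx.2)), hcc⟩
      · have h2 : q v = c := by grind
        refine ⟨fun h' => hvc (h' c (Or.inr h2)).symm, h2⟩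
    · rintro ⟨-, h⟩
      by_cases hvc : v = c
      · exact Or.inl hvc
      · exact Or.inr ⟨hvc, h⟩
  refine l21Number_le_of_isChain hl ?_ ?_
  · rintro (v | v | v)
    · exact (hmem v).1
    · exact (hmem v).2
    · exact hroot
  · rw [hlen, hblen, hsum, Finset.card_compl, Finset.length_toList]
    have := Finset.card_le_univ (starUnmatched q)
    omega

end

end MycielskiUpper

end SimpleGraph

/-! ### The two bounds combined -/

namespace SimpleGraph

theorem l21Number_mycielski_le {V : Type*} [Fintype V] (G : SimpleGraph V) :
    G.mycielski.l21Number ≤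
      2 * Fintype.card V + (Gᶜ.starUnmatchedNumber 4 - 4 + 1) / 2 := by
  obtain ⟨p, hp, hpi⟩ := exists_isStarMap_card_starUnmatched_le_starUnmatchedNumber Gᶜ 4
  have := hp.l21Number_mycielski_le
  omega

/-- The terms `4|S|` from the barrier and from the label count cancel. The hypothesis `5 ≤ i`
ensures `3 ≤ |I|`. -/
theorem le_l21Number_mycielski {V : Type*} [Fintype V] (G : SimpleGraph V)
    (h : 5 ≤ Gᶜ.starUnmatchedNumber 4) :
    2 * Fintype.card V + (Gᶜ.starUnmatchedNumber 4 - 4 + 1) / 2 ≤ G.mycielski.l21Number := by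
  obtain ⟨f, hf, hk⟩ := Nat.sInf_mem (exists_isL21Labeling_le G.mycielski)
  change ∀ x, f x ≤ G.mycielski.l21Number at hk
  obtain ⟨p, hp, S, I, hdisj, hI, hcard⟩ := exists_isStarMap_barrier Gᶜ (m := 4) (by norm_num)
  have h1 := hp.starUnmatchedNumber_le
  have h2 := hf.card_le_of_mycielski hk hdisj (fun v hv w hwv hw => by
    by_contra hvw
    exact hw (hI v hv w ((compl_adj G v w).2 ⟨hwv.symm, hvw⟩))) (by omega)
  omega

end SimpleGraph

theorem theorem3p4 {V : Type*} [Fintype V] (G : SimpleGraph V) (n : ℕ)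
    (hn : Fintype.card V = n) :
    (G.mycielski.l21Number ≤ 2 * n ↔ Gᶜ.starUnmatchedNumber 4 ≤ 4) ∧
    ∀ r : ℕ, 1 ≤ r →
      (G.mycielski.l21Number = 2 * n + r ↔
        ⌈(Gᶜ.starUnmatchedNumber 4 : ℚ) / 2⌉ = (r : ℤ) + 2) := by
  subst hn
  have hub := G.l21Number_mycielski_le
  have hlb := G.le_l21Number_mycielski
  have hceil : ∀ i : ℕ, ⌈(i : ℚ) / 2⌉ = (((i + 1) / 2 : ℕ) : ℤ) := by
    intro i
    rw [Int.ceil_eq_iff]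
    obtain ⟨j, rfl | rfl⟩ := i.even_or_odd'
    · rw [show (2 * j + 1) / 2 = j by omega]
      push_cast
      constructor <;> linarith
    · rw [show (2 * j + 1 + 1) / 2 = j + 1 by omega]
      push_cast
      constructor <;> linarith
  refine ⟨⟨fun h => ?_, fun h => ?_⟩, fun r hr => ?_⟩
  · by_contra! h5
    have := hlb h5
    omega
  · omega
  · rw [hceil]
    by_cases h5 : 5 ≤ Gᶜ.starUnmatchedNumber 4
    · have := hlb h5
      omega
    · omega
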